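/- For $n\ge 2$ and $x_0=(x_{0,1},\dots,x_{0,n})\in\mathbf R^n$, the repeated averaging process started at $x_0$ is the Markov chain $(x_k)_{k\ge 0}$ on $\mathbf R^n$ in which, given $x_k$, two distinct coordinates $I$ and $J$ are picked uniformly at random and both $x_{k,I}$ and $x_{k,J}$ are replaced by $(x_{k,I}+x_{k,J})/2$, all other coordinates being kept, to obtain $x_{k+1}$. Let $T_{x_0}(k)=\sum_{i=1}^n|x_{k,i}-\bar x_0|$, where $\bar x_0=\frac1n\sum_{i=1}^n x_{0,i}$. Let $\mathbf P_n=\{x_0\in\mathbf R^n:\ \min_i x_{0,i}\ge 0,\ \sum_{i=1}^n x_{0,i}=1\}$, and let $\Phi$ be the cumulative distribution function of the standard normal distribution $\mathcal N(0,1)$. Theorem 3. For every $a\in\mathbf R$ and every $\epsilon>0$, as $n\to\infty$, \[\sup_{x_0\in\mathbf P_n}\mathbb P\Bigl[T_{x_0}\bigl(\lfloor n(\log_2 n+a\sqrt{\log_2 n})/2\rfloor\bigr)>2\Phi(-a)+\epsilon\Bigr]\to 0 .\] -/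

import Mathlib

open MeasureTheory ProbabilityTheory Filter Topology
open scoped ENNReal

noncomputable section

namespace RepeatedAverages

/-- Replace both coordinates `p.1` and `p.2` of `x` by their average, keeping all the others. -/
def averagePair {n : ℕ} (x : Fin n → ℝ) (p : Fin n × Fin n) : Fin n → ℝ :=
  fun l => if l = p.1 ∨ l = p.2 then (x p.1 + x p.2) / 2 else x l

/-- The transition law from the state `x`: two distinct coordinates `(I, J)` are picked uniformly at
random and averaged. When `n < 2` there are no two distinct coordinates, and the chain stays put. -/
def step {n : ℕ} (x : Fin n → ℝ) : PMF (Fin n → ℝ) :=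
  if h : (Finset.univ : Finset (Fin n)).offDiag.Nonempty then
    (PMF.uniformOfFinset (Finset.univ : Finset (Fin n)).offDiag h).map (averagePair x)
  else PMF.pure x

/-- The law of the state `x_k` at time `k` of the repeated averaging Markov chain started at `x₀`. -/
def law {n : ℕ} (x₀ : Fin n → ℝ) : ℕ → PMF (Fin n → ℝ)
  | 0 => PMF.pure x₀
  | k + 1 => (law x₀ k).bind step

/-- The mean `(1/n) ∑ i, x i` of the coordinates. -/
def mean {n : ℕ} (x : Fin n → ℝ) : ℝ := (∑ i, x i) / n

/-- The `L¹` distance from the current state `x` to the constant vector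
with entries the mean of the initial state `x₀`. -/
def l1Dist {n : ℕ} (x₀ x : Fin n → ℝ) : ℝ := ∑ i, |x i - mean x₀|

/-- `ℙ[T_{x₀}(k) > c]`, where `T_{x₀}(k) = ∑ i, |x_{k,i} - mean x₀|`
for the chain `x_k` started at `x₀`. -/
def probDistGt {n : ℕ} (x₀ : Fin n → ℝ) (k : ℕ) (c : ℝ) : ℝ≥0∞ :=
  (law x₀ k).toMeasure {x | c < l1Dist x₀ x}

/-- The cumulative distribution function of the standard normal distribution. -/
def stdNormalCDF (t : ℝ) : ℝ := cdf (gaussianReal 0 1) t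

/-- The time `⌊n (log₂ n + a √(log₂ n)) / 2⌋` (the argument of the floor is nonnegative
for all large `n`). -/
def cutoffTime (n : ℕ) (a : ℝ) : ℕ :=
  ⌊(n : ℝ) * (Real.logb 2 n + a * Real.sqrt (Real.logb 2 n)) / 2⌋₊

end RepeatedAverages

end

/-! Follow infinitesimal pieces of the unit mass and count how often each is averaged. A piece is
averaged at each step with probability `2 / n`, wherever it sits, so its count over `k` steps is
binomial with parameters `k` and `2 / n`. At the cutoff time the mean count is about `log₂ n + a
√(log₂ n)`, and a central limit theorem shows that a fraction close to `Φ(-a)` of the mass has count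
below `L = ⌊log₂ n⌋`. This part contributes at most twice its mass to the `L¹` distance, which gives
`2 Φ(-a)`.

The rest must contribute nothing in the limit. Each averaging halves squares on average, so mass
with count at least `L` has expected squared `ℓ²` norm at most `2⁻ᴸ + k / (n (n - 1))`, of order
`log n / n`. Running the chain for `n r` further steps multiplies the squared `ℓ²` distance to the
mean by at most `e⁻ʳ` in expectation, and Cauchy–Schwarz turns this into a small `L¹` distance once
`e⁻ʳ log n → 0`.

The binomial law only gives the mean of the low-count mass. Its variance is at most `2 ‖x‖² + 4 k /
n²`, where `x` is the state in which counting starts, so `n r` initial steps are spent making `‖x‖²`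
small. With `r` of order `(log₂ n)^(1/4)` both extra phases are negligible against the window `n
√(log₂ n)`. All bounds are uniform in the starting point; the pieces are
`pathMean_sum_sq_weightedMass_le`, `pathMean_totalMass_sub_sq_le`, `probDistGt_le_errorBound` and
`tendsto_binomialMean_Iic`. -/

noncomputable section

namespace RepeatedAverages

variable {n : ℕ}

/-! ### Means over random pairs and over paths of pairs -/

/-- The mean of `f` over a uniformly random ordered pair of distinct indices. -/
def pairMean (f : Fin n × Fin n → ℝ) : ℝ :=
  (∑ p ∈ (Finset.univ : Finset (Fin n)).offDiag, f p) / (n * (n - 1))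

theorem pair_count_pos (hn : 2 ≤ n) : (0 : ℝ) < n * (n - 1) := by
  have : (2 : ℝ) ≤ n := by exact_mod_cast hn
  nlinarith

theorem sum_offDiag (f : Fin n × Fin n → ℝ) :
    ∑ p ∈ (Finset.univ : Finset (Fin n)).offDiag, f p = ∑ i, ∑ j, f (i, j) - ∑ i, f (i, i) := by
  have h := Finset.sum_union (Finset.disjoint_diag_offDiag (Finset.univ : Finset (Fin n))) (f := f)
  rw [Finset.diag_union_offDiag, Finset.sum_product, Finset.sum_diag] at h
  linarith

theorem pairMean_mono (hn : 2 ≤ n) {f g : Fin n × Fin n → ℝ}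
    (h : ∀ p : Fin n × Fin n, p.1 ≠ p.2 → f p ≤ g p) : pairMean f ≤ pairMean g := by
  unfold pairMean
  have := pair_count_pos hn
  gcongr with p hp
  exact h p (by simpa using hp)

theorem pairMean_congr {f g : Fin n × Fin n → ℝ}
    (h : ∀ p : Fin n × Fin n, p.1 ≠ p.2 → f p = g p) : pairMean f = pairMean g := by
  unfold pairMean
  rw [Finset.sum_congr rfl fun p hp => h p (by simpa using hp)]

theorem pairMean_add (f g : Fin n × Fin n → ℝ) :
    pairMean (fun p => f p + g p) = pairMean f + pairMean g := by
  simp only [pairMean, Finset.sum_add_distrib, add_div]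

theorem pairMean_const_mul (c : ℝ) (f : Fin n × Fin n → ℝ) :
    pairMean (fun p => c * f p) = c * pairMean f := by
  simp only [pairMean, ← Finset.mul_sum, mul_div_assoc]

theorem pairMean_const (hn : 2 ≤ n) (c : ℝ) :
    pairMean (fun _ : Fin n × Fin n => c) = c := by
  have h := pair_count_pos hn
  rw [pairMean, sum_offDiag]
  simp only [Finset.sum_const, Finset.card_univ, Fintype.card_fin, nsmul_eq_mul]
  rw [div_eq_iff h.ne']
  ring

theorem pairMean_add_coord (hn : 2 ≤ n) (h : Fin n → ℝ) :
    pairMean (fun p => h p.1 + h p.2) = 2 / n * ∑ i, h i := by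
  have hp := pair_count_pos hn
  have hn0 : (n : ℝ) ≠ 0 := by positivity
  rw [pairMean, sum_offDiag]
  simp only [Finset.sum_add_distrib, Finset.sum_const, Finset.card_univ, Fintype.card_fin,
    nsmul_eq_mul, ← Finset.mul_sum]
  rw [div_eq_iff hp.ne']
  field_simp
  ring

theorem pairMean_add_mul_add (hn : 2 ≤ n) (h g : Fin n → ℝ) :
    pairMean (fun p => (h p.1 + h p.2) * (g p.1 + g p.2)) =
      2 / n * ∑ i, h i * g i +
        2 / (n * (n - 1)) * ((∑ i, h i) * (∑ i, g i) - ∑ i, h i * g i) := by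
  have hp := pair_count_pos hn
  have hn0 : (n : ℝ) ≠ 0 := by positivity
  have hn1 : (n : ℝ) - 1 ≠ 0 := by
    intro h0; rw [h0] at hp; simp at hp
  rw [pairMean, sum_offDiag]
  simp only [add_mul, mul_add, Finset.sum_add_distrib, Finset.sum_const, Finset.card_univ,
    Fintype.card_fin, nsmul_eq_mul, ← Finset.mul_sum, ← Finset.sum_mul]
  rw [div_eq_iff hp.ne']
  field_simp
  ring

/-- The mean of `F` over `k` independent uniformly random pairs of distinct indices, listed with the
most recent pair first. -/
def pathMean : ℕ → (List (Fin n × Fin n) → ℝ) → ℝ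
  | 0, F => F []
  | k + 1, F => pathMean k fun ps => pairMean fun p => F (p :: ps)

theorem pathMean_mono (hn : 2 ≤ n) (k : ℕ) {F G : List (Fin n × Fin n) → ℝ}
    (h : ∀ ps, F ps ≤ G ps) : pathMean k F ≤ pathMean k G := by
  induction k generalizing F G with
  | zero => exact h []
  | succ k ih => exact ih fun ps => pairMean_mono hn fun p _ => h _

theorem pathMean_add (k : ℕ) (F G : List (Fin n × Fin n) → ℝ) :
    pathMean k (fun ps => F ps + G ps) = pathMean k F + pathMean k G := by
  induction k generalizing F G with
  | zero => rfl
  | succ k ih => simp only [pathMean, pairMean_add, ih]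

theorem pathMean_const_mul (k : ℕ) (c : ℝ) (F : List (Fin n × Fin n) → ℝ) :
    pathMean k (fun ps => c * F ps) = c * pathMean k F := by
  induction k generalizing F with
  | zero => rfl
  | succ k ih => simp only [pathMean, pairMean_const_mul, ih]

theorem pathMean_const (hn : 2 ≤ n) (k : ℕ) (c : ℝ) :
    pathMean k (fun _ : List (Fin n × Fin n) => c) = c := by
  induction k with
  | zero => rfl
  | succ k ih => simp only [pathMean, pairMean_const hn, ih]

/-- The Markov property: the newest pairs head the list, so the last `k` steps form the prefix `qs`.
-/
theorem pathMean_append (j k : ℕ) (F : List (Fin n × Fin n) → ℝ) :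
    pathMean (j + k) F = pathMean j fun ps => pathMean k fun qs => F (qs ++ ps) := by
  induction k generalizing F with
  | zero => rfl
  | succ k ih => exact ih fun ps => pairMean fun p => F (p :: ps)

/-! ### Trajectories and contraction in `ℓ²` -/

/-- The state reached from `x` along the list `ps` of pairs, the most recent pair first. -/
def run (x : Fin n → ℝ) : List (Fin n × Fin n) → Fin n → ℝ
  | [] => x
  | p :: ps => averagePair (run x ps) p

theorem run_append (x : Fin n → ℝ) (qs ps : List (Fin n × Fin n)) :
    run x (qs ++ ps) = run (run x ps) qs := by
  induction qs with
  | nil => rfl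
  | cons q qs ih => simp only [List.cons_append, run, ih]

theorem run_add (x y : Fin n → ℝ) (ps : List (Fin n × Fin n)) :
    run (x + y) ps = run x ps + run y ps := by
  induction ps with
  | nil => rfl
  | cons p ps ih =>
    funext l
    simp only [run, ih, averagePair, Pi.add_apply]
    split_ifs <;> ring

theorem run_const (c : ℝ) (ps : List (Fin n × Fin n)) :
    run (fun _ => c) ps = fun _ => c := by
  induction ps with
  | nil => rfl
  | cons p ps ih =>
    funext l
    simp only [run, ih, averagePair]
    split_ifs <;> ring

theorem run_nonneg {x : Fin n → ℝ} (hx : ∀ i, 0 ≤ x i) (ps : List (Fin n × Fin n)) (i : Fin n) :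
    0 ≤ run x ps i := by
  induction ps generalizing i with
  | nil => exact hx i
  | cons p ps ih =>
    simp only [run, averagePair]
    split_ifs
    · linarith [ih p.1, ih p.2]
    · exact ih i

theorem sum_ite_pair {i j : Fin n} (h : i ≠ j) (c : ℝ) (g : Fin n → ℝ) :
    ∑ l, (if l = i ∨ l = j then c else g l) = ∑ l, g l - (g i + g j) + 2 * c := by
  have : ∀ l, (if l = i ∨ l = j then c else g l) =
      g l + ((if l = i then c - g i else 0) + (if l = j then c - g j else 0)) := by
    intro l
    by_cases hi : l = i
    · subst hi; simp [h]
    · by_cases hj : l = j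
      · subst hj; simp [hi]
      · simp [hi, hj]
  simp only [this, Finset.sum_add_distrib, Finset.sum_ite_eq', Finset.mem_univ, if_true]
  ring

theorem sum_averagePair (x : Fin n → ℝ) (p : Fin n × Fin n) :
    ∑ l, averagePair x p l = ∑ l, x l := by
  by_cases h : p.1 = p.2
  · refine Finset.sum_congr rfl fun l _ => ?_
    simp only [averagePair, h, or_self]
    split_ifs with hl
    · rw [hl]; ring
    · rfl
  · simp only [averagePair, sum_ite_pair h]
    ring

theorem sum_run (x : Fin n → ℝ) (ps : List (Fin n × Fin n)) : ∑ l, run x ps l = ∑ l, x l := by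
  induction ps with
  | nil => rfl
  | cons p ps ih => rw [run, sum_averagePair, ih]

/-- The right side is arranged for `pairMean_add_coord` and `pairMean_add_mul_add`. -/
theorem sum_sq_averagePair (x : Fin n → ℝ) {p : Fin n × Fin n} (h : p.1 ≠ p.2) :
    ∑ l, averagePair x p l ^ 2 =
      ∑ l, x l ^ 2 + ((-1) * (x p.1 ^ 2 + x p.2 ^ 2)
        + 1 / 2 * ((x p.1 + x p.2) * (x p.1 + x p.2))) := by
  simp only [averagePair, ite_pow, sum_ite_pair h]
  ring

/-- Since the coordinates sum to zero, the cross terms contribute only `-1 / (n (n - 1))` times the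
sum of squares, which is dropped. -/
theorem pairMean_sum_sq_averagePair_le (hn : 2 ≤ n) {x : Fin n → ℝ} (hx : ∑ l, x l = 0) :
    pairMean (fun p => ∑ l, averagePair x p l ^ 2) ≤ (1 - 1 / n) * ∑ l, x l ^ 2 := by
  have hp := pair_count_pos hn
  rw [pairMean_congr fun p hp => sum_sq_averagePair x hp, pairMean_add, pairMean_const hn,
    pairMean_add, pairMean_const_mul, pairMean_const_mul,
    pairMean_add_coord hn (fun i => x i ^ 2), pairMean_add_mul_add hn, hx]
  have h0 : 0 ≤ ∑ l, x l ^ 2 := Finset.sum_nonneg fun _ _ => sq_nonneg _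
  have h1 : 0 ≤ 1 / ((n : ℝ) * (n - 1)) := by positivity
  have h2 : ∑ i, x i * x i = ∑ i, x i ^ 2 := by simp only [sq]
  rw [h2]
  have : 2 / ((n : ℝ) * (n - 1)) = 2 * (1 / ((n : ℝ) * (n - 1))) := by ring
  rw [this]
  have h3 : (2 : ℝ) / n = 2 * (1 / n) := by ring
  rw [h3]
  nlinarith [mul_nonneg h1 h0]

theorem one_sub_inv_nonneg (hn : 2 ≤ n) : (0 : ℝ) ≤ 1 - 1 / n := by
  have : (1 : ℝ) ≤ n := by exact_mod_cast (by omega : 1 ≤ n)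
  rw [sub_nonneg, div_le_one (by linarith)]
  exact this

theorem pathMean_sum_sq_run_le (hn : 2 ≤ n) {x : Fin n → ℝ} (hx : ∑ l, x l = 0) (k : ℕ) :
    pathMean k (fun ps => ∑ l, run x ps l ^ 2) ≤ (1 - 1 / (n : ℝ)) ^ k * ∑ l, x l ^ 2 := by
  induction k with
  | zero => simp [pathMean, run]
  | succ k ih =>
    calc pathMean (k + 1) (fun ps => ∑ l, run x ps l ^ 2)
        ≤ pathMean k (fun ps => (1 - 1 / (n : ℝ)) * ∑ l, run x ps l ^ 2) :=
          pathMean_mono hn k fun ps =>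
            pairMean_sum_sq_averagePair_le hn (by rw [sum_run, hx])
      _ ≤ _ := by
          rw [pathMean_const_mul, pow_succ']
          rw [mul_assoc]
          exact mul_le_mul_of_nonneg_left ih (one_sub_inv_nonneg hn)

theorem sum_sub_mean (hn : 2 ≤ n) (x : Fin n → ℝ) : ∑ l, (x l - mean x) = 0 := by
  have hn0 : (n : ℝ) ≠ 0 := by positivity
  simp [mean, Finset.sum_sub_distrib]
  field_simp
  ring

theorem sum_sq_sub_mean (hn : 2 ≤ n) (x : Fin n → ℝ) :
    ∑ l, (x l - mean x) ^ 2 = ∑ l, x l ^ 2 - (∑ l, x l) ^ 2 / n := by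
  have hn0 : (n : ℝ) ≠ 0 := by positivity
  have : ∀ l, (x l - mean x) ^ 2 = x l ^ 2 - 2 * mean x * x l + mean x ^ 2 := fun l => by ring
  simp only [this, Finset.sum_add_distrib, Finset.sum_sub_distrib, ← Finset.mul_sum,
    Finset.sum_const, Finset.card_univ, Fintype.card_fin, nsmul_eq_mul]
  simp only [mean]
  field_simp
  ring

theorem run_sub_const (x : Fin n → ℝ) (c : ℝ) (ps : List (Fin n × Fin n)) :
    run (fun l => x l - c) ps = fun l => run x ps l - c := by
  have h := run_add x (fun _ => -c) ps
  rw [run_const] at h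
  exact h

/-- The squared Euclidean distance to the mean contracts geometrically in expectation. -/
theorem pathMean_sum_sq_run_sub_mean_le (hn : 2 ≤ n) (x : Fin n → ℝ) (k : ℕ) :
    pathMean k (fun ps => ∑ l, (run x ps l - mean x) ^ 2) ≤
      (1 - 1 / (n : ℝ)) ^ k * ∑ l, x l ^ 2 := by
  have h := pathMean_sum_sq_run_le hn (sum_sub_mean hn x) k
  simp only [run_sub_const] at h
  refine h.trans ?_
  rw [sum_sq_sub_mean hn]
  have := one_sub_inv_nonneg hn
  gcongr
  have : 0 ≤ (∑ l, x l) ^ 2 / n := by positivity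
  linarith

/-- Pythagoras: the constant vector `1 / n` has squared norm `1 / n`. -/
theorem pathMean_sum_sq_run_le_add (hn : 2 ≤ n) {x : Fin n → ℝ} (hx : ∑ l, x l = 1) (k : ℕ) :
    pathMean k (fun ps => ∑ l, run x ps l ^ 2) ≤
      (1 - 1 / (n : ℝ)) ^ k * ∑ l, x l ^ 2 + 1 / n := by
  have h := pathMean_sum_sq_run_sub_mean_le hn x k
  have hm : ∀ ps, mean x = mean (run x ps) := fun ps => by simp only [mean, sum_run]
  have : (fun ps => ∑ l, run x ps l ^ 2) =
      fun ps => ∑ l, (run x ps l - mean x) ^ 2 + 1 / n := by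
    funext ps
    rw [hm ps, sum_sq_sub_mean hn, sum_run, hx]
    ring
  rw [this, pathMean_add, pathMean_const hn]
  linarith

/-! ### Mass weighted by the number of averagings -/

/-- The mass at each site, where a unit of mass that has been averaged `m` times has weight `φ m`. -/
def weightedMass (x : Fin n → ℝ) : List (Fin n × Fin n) → (ℕ → ℝ) → Fin n → ℝ
  | [], φ => fun l => φ 0 * x l
  | p :: ps, φ => fun l =>
      if l = p.1 ∨ l = p.2 then
        (weightedMass x ps (fun m => φ (m + 1)) p.1 +
          weightedMass x ps (fun m => φ (m + 1)) p.2) / 2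
      else weightedMass x ps φ l

theorem weightedMass_one (x : Fin n → ℝ) (ps : List (Fin n × Fin n)) :
    weightedMass x ps (fun _ => 1) = run x ps := by
  induction ps with
  | nil => funext l; simp [weightedMass, run]
  | cons p ps ih => funext l; simp only [weightedMass, run, averagePair, ih]

theorem weightedMass_add (x : Fin n → ℝ) (ps : List (Fin n × Fin n)) (φ ψ : ℕ → ℝ) (l : Fin n) :
    weightedMass x ps (fun m => φ m + ψ m) l = weightedMass x ps φ l + weightedMass x ps ψ l := by
  induction ps generalizing φ ψ l with
  | nil => simp only [weightedMass]; ring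
  | cons p ps ih =>
    simp only [weightedMass, ih]
    split_ifs <;> ring

theorem weightedMass_nonneg {x : Fin n → ℝ} (hx : ∀ i, 0 ≤ x i) (ps : List (Fin n × Fin n))
    {φ : ℕ → ℝ} (hφ : ∀ m, 0 ≤ φ m) (l : Fin n) : 0 ≤ weightedMass x ps φ l := by
  induction ps generalizing φ l with
  | nil => exact mul_nonneg (hφ 0) (hx l)
  | cons p ps ih =>
    simp only [weightedMass]
    split_ifs
    · linarith [ih (fun m => hφ (m + 1)) p.1, ih (fun m => hφ (m + 1)) p.2]
    · exact ih hφ l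

theorem weightedMass_mono {x : Fin n → ℝ} (hx : ∀ i, 0 ≤ x i) (ps : List (Fin n × Fin n))
    {φ ψ : ℕ → ℝ} (h : ∀ m, φ m ≤ ψ m) (l : Fin n) :
    weightedMass x ps φ l ≤ weightedMass x ps ψ l := by
  have h1 := weightedMass_add x ps φ (fun m => ψ m - φ m) l
  have h2 := weightedMass_nonneg hx ps (fun m => sub_nonneg.2 (h m)) l
  simp only [add_sub_cancel] at h1
  linarith

theorem weightedMass_le_run {x : Fin n → ℝ} (hx : ∀ i, 0 ≤ x i) (ps : List (Fin n × Fin n))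
    {φ : ℕ → ℝ} (hφ : ∀ m, φ m ≤ 1) (l : Fin n) : weightedMass x ps φ l ≤ run x ps l := by
  rw [← weightedMass_one]
  exact weightedMass_mono hx ps hφ l

/-- The total weighted mass. -/
def totalMass (x : Fin n → ℝ) (ps : List (Fin n × Fin n)) (φ : ℕ → ℝ) : ℝ :=
  ∑ l, weightedMass x ps φ l

theorem totalMass_cons (x : Fin n → ℝ) (ps : List (Fin n × Fin n)) (φ : ℕ → ℝ)
    {p : Fin n × Fin n} (h : p.1 ≠ p.2) :
    totalMass x (p :: ps) φ = totalMass x ps φ +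
      ((weightedMass x ps (fun m => φ (m + 1)) p.1 - weightedMass x ps φ p.1) +
        (weightedMass x ps (fun m => φ (m + 1)) p.2 - weightedMass x ps φ p.2)) := by
  simp only [totalMass, weightedMass, sum_ite_pair h]
  ring

/-- The mean of `φ` under the binomial distribution with parameters `k` and `q`. -/
def binomialMean (q : ℝ) : ℕ → (ℕ → ℝ) → ℝ
  | 0, φ => φ 0
  | k + 1, φ => (1 - q) * binomialMean q k φ + q * binomialMean q k fun m => φ (m + 1)

/-- Every site belongs to the random pair with probability `2 / n`, so the position of the mass is
irrelevant and `φ` is replaced by its shift with that probability. -/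
theorem pathMean_totalMass (hn : 2 ≤ n) {x : Fin n → ℝ} (hx : ∑ l, x l = 1) (k : ℕ)
    (φ : ℕ → ℝ) : pathMean k (fun ps => totalMass x ps φ) = binomialMean (2 / n) k φ := by
  induction k generalizing φ with
  | zero => simp [pathMean, totalMass, weightedMass, ← Finset.mul_sum, hx, binomialMean]
  | succ k ih =>
    have : (fun ps => pairMean fun p => totalMass x (p :: ps) φ) = fun ps =>
        (1 - 2 / (n : ℝ)) * totalMass x ps φ + 2 / n * totalMass x ps (fun m => φ (m + 1)) := by
      funext ps
      rw [pairMean_congr fun p hp => totalMass_cons x ps φ hp, pairMean_add, pairMean_const hn,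
        pairMean_add_coord hn (fun l => weightedMass x ps (fun m => φ (m + 1)) l -
          weightedMass x ps φ l), Finset.sum_sub_distrib]
      simp only [totalMass]
      ring
    rw [pathMean, this, pathMean_add, pathMean_const_mul, pathMean_const_mul, ih, ih, binomialMean]

theorem totalMass_nonneg {x : Fin n → ℝ} (hx : ∀ i, 0 ≤ x i) (ps : List (Fin n × Fin n))
    {φ : ℕ → ℝ} (hφ : ∀ m, 0 ≤ φ m) : 0 ≤ totalMass x ps φ :=
  Finset.sum_nonneg fun l _ => weightedMass_nonneg hx ps hφ l

theorem totalMass_le_one {x : Fin n → ℝ} (hx : ∀ i, 0 ≤ x i) (hs : ∑ l, x l = 1)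
    (ps : List (Fin n × Fin n)) {φ : ℕ → ℝ} (hφ : ∀ m, φ m ≤ 1) : totalMass x ps φ ≤ 1 := by
  rw [← hs, ← sum_run x ps]
  exact Finset.sum_le_sum fun l _ => weightedMass_le_run hx ps hφ l

/-- A site is hit with probability `2 / n`, and averaging then halves its square: hence `1 / n`. The
products of two distinct sites sum to at most the squared total mass, hence at most `1`. -/
theorem pairMean_sum_sq_weightedMass_cons_le (hn : 2 ≤ n) {x : Fin n → ℝ} (hx : ∀ i, 0 ≤ x i)
    (hs : ∑ l, x l = 1) (ps : List (Fin n × Fin n)) {φ : ℕ → ℝ} (h0 : ∀ m, 0 ≤ φ m)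
    (h1 : ∀ m, φ m ≤ 1) :
    pairMean (fun p => ∑ l, weightedMass x (p :: ps) φ l ^ 2) ≤
      (1 - 2 / (n : ℝ)) * ∑ l, weightedMass x ps φ l ^ 2 +
        (1 / n * ∑ l, weightedMass x ps (fun m => φ (m + 1)) l ^ 2 + 1 / (n * (n - 1))) := by
  have hp := pair_count_pos hn
  set f := weightedMass x ps φ
  set g := weightedMass x ps (fun m => φ (m + 1)) with hg
  have key : ∀ p : Fin n × Fin n, p.1 ≠ p.2 → ∑ l, weightedMass x (p :: ps) φ l ^ 2 =
      ∑ l, f l ^ 2 + ((-1) * (f p.1 ^ 2 + f p.2 ^ 2)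
        + 1 / 2 * ((g p.1 + g p.2) * (g p.1 + g p.2))) := by
    intro p hp
    simp only [weightedMass, ite_pow, sum_ite_pair hp]
    ring
  rw [pairMean_congr key, pairMean_add, pairMean_const hn, pairMean_add, pairMean_const_mul,
    pairMean_const_mul, pairMean_add_coord hn (fun i => f i ^ 2), pairMean_add_mul_add hn]
  have hG0 : 0 ≤ ∑ l, g l := totalMass_nonneg hx ps fun m => h0 (m + 1)
  have hG1 : ∑ l, g l ≤ 1 := totalMass_le_one hx hs ps fun m => h1 (m + 1)
  have h2 : ∑ i, g i * g i = ∑ i, g i ^ 2 := by simp only [sq]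
  have h3 : 0 ≤ ∑ l, g l ^ 2 := Finset.sum_nonneg fun _ _ => sq_nonneg _
  rw [h2]
  have h4 : (∑ l, g l) * (∑ l, g l) - ∑ l, g l ^ 2 ≤ 1 := by nlinarith
  have h5 : 2 / ((n : ℝ) * (n - 1)) = 2 * (1 / ((n : ℝ) * (n - 1))) := by ring
  have h6 : (2 : ℝ) / n = 2 * (1 / n) := by ring
  have h7 : 0 ≤ 1 / ((n : ℝ) * (n - 1)) := by positivity
  have h8 := mul_le_mul_of_nonneg_left h4 h7
  rw [h5, h6]
  linarith

/-- Mass that has been averaged at least `L` times is spread out in the `ℓ²` sense. -/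
theorem pathMean_sum_sq_weightedMass_le (hn : 2 ≤ n) {x : Fin n → ℝ} (hx : ∀ i, 0 ≤ x i)
    (hs : ∑ l, x l = 1) (k L : ℕ) :
    pathMean k (fun ps => ∑ l, weightedMass x ps (fun m => if L ≤ m then 1 else 0) l ^ 2) ≤
      (1 / 2) ^ L + k / (n * (n - 1)) := by
  have hp := pair_count_pos hn
  have hn2 : (2 : ℝ) ≤ n := by exact_mod_cast hn
  have hq : 0 ≤ 1 - 2 / (n : ℝ) := by
    rw [sub_nonneg, div_le_one (by linarith)]; exact hn2
  induction k generalizing L with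
  | zero =>
    simp only [pathMean, weightedMass]
    rcases L with _ | L
    · have : ∑ l, x l ^ 2 ≤ (∑ l, x l) ^ 2 :=
        Finset.sum_sq_le_sq_sum_of_nonneg fun i _ => hx i
      simpa [hs] using this
    · simp
  | succ k ih =>
    rw [pathMean]
    refine (pathMean_mono hn k fun ps => pairMean_sum_sq_weightedMass_cons_le hn hx hs ps
      (fun m => by split_ifs <;> simp) (fun m => by split_ifs <;> simp)).trans ?_
    rw [pathMean_add, pathMean_add, pathMean_const_mul, pathMean_const_mul, pathMean_const hn]
    have h1 := mul_le_mul_of_nonneg_left (ih L) hq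
    have hn1 : (0 : ℝ) ≤ 1 / n := by positivity
    have hK : 0 ≤ (k : ℝ) / (n * (n - 1)) := by positivity
    have h6 : (2 : ℝ) / n = 2 * (1 / n) := by ring
    have e : ((k + 1 : ℕ) : ℝ) / (n * (n - 1)) = k / (n * (n - 1)) + 1 / (n * (n - 1)) := by
      push_cast; ring
    rcases L with _ | L
    · have h2 := mul_le_mul_of_nonneg_left (ih 0) hn1
      simp only [Nat.zero_le, if_true] at h1 h2 ⊢
      rw [e]
      rw [h6] at *
      nlinarith [mul_nonneg hn1 hK]
    -- The shift lowers the threshold by one, and the power of `1 / 2` is reproduced exactly: `(1 -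
    -- 2/n) 2^(-L-1) + (1/n) 2^(-L) = 2^(-L-1)`.
    · have h2 := mul_le_mul_of_nonneg_left (ih L) hn1
      simp only [Nat.add_le_add_iff_right] at h1 h2 ⊢
      rw [e]
      rw [pow_succ] at *
      rw [h6] at *
      nlinarith [mul_nonneg hn1 hK]

/-! ### Concentration of the total weighted mass -/

theorem abs_weightedMass_sub_le {x : Fin n → ℝ} (hx : ∀ i, 0 ≤ x i) (ps : List (Fin n × Fin n))
    {φ ψ : ℕ → ℝ} (h0 : ∀ m, 0 ≤ φ m) (h1 : ∀ m, φ m ≤ 1) (h2 : ∀ m, 0 ≤ ψ m)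
    (h3 : ∀ m, ψ m ≤ 1) (l : Fin n) :
    |weightedMass x ps φ l - weightedMass x ps ψ l| ≤ run x ps l := by
  rw [abs_sub_le_iff]
  constructor
  · linarith [weightedMass_nonneg hx ps h2 l, weightedMass_le_run hx ps h1 l]
  · linarith [weightedMass_nonneg hx ps h0 l, weightedMass_le_run hx ps h3 l]

/-- The main term is the product of the two one-step conditional means; the rest bounds their
covariance. Two test functions are needed even for a variance, because the recursion pairs `φ` with
shifts of `ψ`. -/
theorem pairMean_totalMass_cons_mul_le (hn : 2 ≤ n) {x : Fin n → ℝ} (hx : ∀ i, 0 ≤ x i)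
    (hs : ∑ l, x l = 1) (ps : List (Fin n × Fin n)) {φ ψ : ℕ → ℝ} (h0 : ∀ m, 0 ≤ φ m)
    (h1 : ∀ m, φ m ≤ 1) (h2 : ∀ m, 0 ≤ ψ m) (h3 : ∀ m, ψ m ≤ 1) :
    pairMean (fun p => totalMass x (p :: ps) φ * totalMass x (p :: ps) ψ) ≤
      ((1 - 2 / (n : ℝ)) * totalMass x ps φ + 2 / n * totalMass x ps (fun m => φ (m + 1))) *
      ((1 - 2 / (n : ℝ)) * totalMass x ps ψ + 2 / n * totalMass x ps (fun m => ψ (m + 1))) +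
      (2 / n * ∑ l, run x ps l ^ 2 + 2 / n ^ 2) := by
  have hp := pair_count_pos hn
  have hn2 : (2 : ℝ) ≤ n := by exact_mod_cast hn
  set h : Fin n → ℝ := fun l => weightedMass x ps (fun m => φ (m + 1)) l - weightedMass x ps φ l
    with hh
  set g : Fin n → ℝ := fun l => weightedMass x ps (fun m => ψ (m + 1)) l - weightedMass x ps ψ l
    with hg
  have hH : ∑ l, h l = totalMass x ps (fun m => φ (m + 1)) - totalMass x ps φ := by
    simp only [hh, Finset.sum_sub_distrib, totalMass]
  have hG : ∑ l, g l = totalMass x ps (fun m => ψ (m + 1)) - totalMass x ps ψ := by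
    simp only [hg, Finset.sum_sub_distrib, totalMass]
  have key : ∀ p : Fin n × Fin n, p.1 ≠ p.2 → totalMass x (p :: ps) φ * totalMass x (p :: ps) ψ =
      totalMass x ps φ * totalMass x ps ψ + (totalMass x ps φ * (g p.1 + g p.2) +
        (totalMass x ps ψ * (h p.1 + h p.2) + (h p.1 + h p.2) * (g p.1 + g p.2))) := by
    intro p hp
    rw [totalMass_cons x ps φ hp, totalMass_cons x ps ψ hp]
    ring
  rw [pairMean_congr key, pairMean_add, pairMean_const hn, pairMean_add, pairMean_const_mul,
    pairMean_add_coord hn g, pairMean_add, pairMean_const_mul, pairMean_add_coord hn h,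
    pairMean_add_mul_add hn, hH, hG]
  have a1 := totalMass_nonneg hx ps h0
  have a2 := totalMass_nonneg hx ps h2
  have a3 := totalMass_nonneg hx ps fun m => h0 (m + 1)
  have a4 := totalMass_nonneg hx ps fun m => h2 (m + 1)
  have b1 := totalMass_le_one hx hs ps h1
  have b2 := totalMass_le_one hx hs ps h3
  have b3 := totalMass_le_one hx hs ps fun m => h1 (m + 1)
  have b4 := totalMass_le_one hx hs ps fun m => h3 (m + 1)
  set F := totalMass x ps φ
  set G := totalMass x ps ψ
  set F' := totalMass x ps fun m => φ (m + 1)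
  set G' := totalMass x ps fun m => ψ (m + 1)
  have hc : ∑ l, h l * g l ≤ ∑ l, run x ps l ^ 2 := by
    refine Finset.sum_le_sum fun l _ => ?_
    have e1 := abs_weightedMass_sub_le hx ps (fun m => h0 (m + 1)) (fun m => h1 (m + 1)) h0 h1 l
    have e2 := abs_weightedMass_sub_le hx ps (fun m => h2 (m + 1)) (fun m => h3 (m + 1)) h2 h3 l
    calc h l * g l ≤ |h l * g l| := le_abs_self _
      _ = |h l| * |g l| := abs_mul _ _
      _ ≤ run x ps l * run x ps l := mul_le_mul e1 e2 (abs_nonneg _) (run_nonneg hx ps l)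
      _ = _ := by ring
  have hD : |(F' - F) * (G' - G)| ≤ 1 := by
    rw [abs_mul]
    exact mul_le_one₀ (abs_le.2 ⟨by linarith, by linarith⟩) (abs_nonneg _)
      (abs_le.2 ⟨by linarith, by linarith⟩)
  have hR : 0 ≤ ∑ l, run x ps l ^ 2 := Finset.sum_nonneg fun _ _ => sq_nonneg _
  set D := (F' - F) * (G' - G) with hDdef
  set C := ∑ l, h l * g l
  set R := ∑ l, run x ps l ^ 2
  have hn1 : (0 : ℝ) < n - 1 := by linarith
  have hq : 2 / ((n : ℝ) * (n - 1)) ≤ 2 / n := by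
    apply div_le_div_of_nonneg_left <;> nlinarith
  have hq0 : 0 ≤ 2 / ((n : ℝ) * (n - 1)) := by positivity
  have c1 : (2 / (n : ℝ) - 2 / (n * (n - 1))) * C ≤ 2 / n * R :=
    (mul_le_mul_of_nonneg_left hc (by linarith)).trans
      (mul_le_mul_of_nonneg_right (by linarith) hR)
  -- The two indices are distinct, not independent; this is the cost of comparing the two cases.
  have c2 : |2 / ((n : ℝ) * (n - 1)) - (2 / n) ^ 2| ≤ 2 / (n : ℝ) ^ 2 := by
    have : 2 / ((n : ℝ) * (n - 1)) - (2 / n) ^ 2 = -(2 / n ^ 2 * ((n - 2) / (n - 1))) := by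
      field_simp
      ring
    rw [this, abs_neg, abs_of_nonneg (by
      have : (0 : ℝ) ≤ n - 2 := by linarith
      positivity)]
    refine mul_le_of_le_one_right (by positivity) ?_
    rw [div_le_one hn1]; linarith
  have c3 : (2 / ((n : ℝ) * (n - 1)) - (2 / n) ^ 2) * D ≤ 2 / n ^ 2 := by
    refine (le_abs_self _).trans ?_
    rw [abs_mul]
    calc _ ≤ 2 / (n : ℝ) ^ 2 * 1 := mul_le_mul c2 hD (abs_nonneg _) (by positivity)
      _ = _ := mul_one _
  have expand : ((1 - 2 / (n : ℝ)) * F + 2 / n * F') * ((1 - 2 / (n : ℝ)) * G + 2 / n * G') =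
      F * G + 2 / n * F * (G' - G) + 2 / n * G * (F' - F) + (2 / n) ^ 2 * D := by
    rw [hDdef]; ring
  rw [expand]
  linarith

/-- The total weighted masses are almost uncorrelated when the initial mass is spread out. -/
theorem pathMean_totalMass_mul_le (hn : 2 ≤ n) {x : Fin n → ℝ} (hx : ∀ i, 0 ≤ x i)
    (hs : ∑ l, x l = 1) (k : ℕ) {φ ψ : ℕ → ℝ} (h0 : ∀ m, 0 ≤ φ m)
    (h1 : ∀ m, φ m ≤ 1) (h2 : ∀ m, 0 ≤ ψ m) (h3 : ∀ m, ψ m ≤ 1) :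
    pathMean k (fun ps => totalMass x ps φ * totalMass x ps ψ) ≤
      binomialMean (2 / n) k φ * binomialMean (2 / n) k ψ +
        (2 * (∑ l, x l ^ 2) * (1 - (1 - 1 / (n : ℝ)) ^ k) + 4 * k / n ^ 2) := by
  have hn2 : (2 : ℝ) ≤ n := by exact_mod_cast hn
  have hp0 : (0 : ℝ) ≤ 2 / n := by positivity
  have hq : 0 ≤ 1 - 2 / (n : ℝ) := by
    rw [sub_nonneg, div_le_one (by linarith)]; exact hn2
  induction k generalizing φ ψ with
  | zero =>
    simp [pathMean, totalMass, weightedMass, ← Finset.mul_sum, hs, binomialMean]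
  | succ k ih =>
    rw [pathMean]
    refine (pathMean_mono hn k fun ps =>
      pairMean_totalMass_cons_mul_le hn hx hs ps h0 h1 h2 h3).trans ?_
    have e : (fun ps => ((1 - 2 / (n : ℝ)) * totalMass x ps φ
          + 2 / n * totalMass x ps (fun m => φ (m + 1))) *
        ((1 - 2 / (n : ℝ)) * totalMass x ps ψ + 2 / n * totalMass x ps (fun m => ψ (m + 1))) +
        (2 / n * ∑ l, run x ps l ^ 2 + 2 / n ^ 2)) = fun ps =>
        (((1 - 2 / (n : ℝ)) * (1 - 2 / n)) * (totalMass x ps φ * totalMass x ps ψ) +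
        (((1 - 2 / (n : ℝ)) * (2 / n)) *
          (totalMass x ps φ * totalMass x ps (fun m => ψ (m + 1))) +
        (((2 / (n : ℝ)) * (1 - 2 / n)) *
          (totalMass x ps (fun m => φ (m + 1)) * totalMass x ps ψ) +
        ((2 / (n : ℝ)) * (2 / n)) *
          (totalMass x ps (fun m => φ (m + 1)) * totalMass x ps (fun m => ψ (m + 1)))))) +
        (2 / n * ∑ l, run x ps l ^ 2 + 2 / n ^ 2) := by
      funext ps; ring
    rw [e]
    simp only [pathMean_add, pathMean_const_mul, pathMean_const hn, binomialMean]
    have i1 := mul_le_mul_of_nonneg_left (ih h0 h1 h2 h3) (mul_nonneg hq hq)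
    have i2 := mul_le_mul_of_nonneg_left (ih h0 h1 (fun m => h2 (m + 1)) (fun m => h3 (m + 1)))
      (mul_nonneg hq hp0)
    have i3 := mul_le_mul_of_nonneg_left (ih (fun m => h0 (m + 1)) (fun m => h1 (m + 1)) h2 h3)
      (mul_nonneg hp0 hq)
    have i4 := mul_le_mul_of_nonneg_left (ih (fun m => h0 (m + 1)) (fun m => h1 (m + 1))
      (fun m => h2 (m + 1)) (fun m => h3 (m + 1))) (mul_nonneg hp0 hp0)
    have i5 := mul_le_mul_of_nonneg_left (pathMean_sum_sq_run_le_add hn hs k) hp0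
    set S := ∑ l, x l ^ 2
    set E := 2 * S * (1 - (1 - 1 / (n : ℝ)) ^ k) + 4 * k / n ^ 2 with hE
    -- The error is the sum of the one-step covariances: the geometric part sums to `2 S (1 - (1 -
    -- 1/n)^k)`, and each step adds `2/n · 1/n + 2/n² = 4/n²`.
    have e2 : 2 * S * (1 - (1 - 1 / (n : ℝ)) ^ (k + 1)) + 4 * ((k + 1 : ℕ) : ℝ) / n ^ 2 =
        E + (2 / n * ((1 - 1 / (n : ℝ)) ^ k * S + 1 / n) + 2 / n ^ 2) := by
      rw [hE, pow_succ]; push_cast; ring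
    rw [e2]
    linarith

theorem pathMean_totalMass_sub_sq_le (hn : 2 ≤ n) {x : Fin n → ℝ} (hx : ∀ i, 0 ≤ x i)
    (hs : ∑ l, x l = 1) (k : ℕ) {φ : ℕ → ℝ} (h0 : ∀ m, 0 ≤ φ m) (h1 : ∀ m, φ m ≤ 1) :
    pathMean k (fun ps => (totalMass x ps φ - binomialMean (2 / n) k φ) ^ 2) ≤
      2 * ∑ l, x l ^ 2 + 4 * k / n ^ 2 := by
  have h := pathMean_totalMass_mul_le hn hx hs k h0 h1 h0 h1
  have e : (fun ps => (totalMass x ps φ - binomialMean (2 / n) k φ) ^ 2) = fun ps =>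
      totalMass x ps φ * totalMass x ps φ + ((-2 * binomialMean (2 / n) k φ) * totalMass x ps φ +
        binomialMean (2 / n) k φ ^ 2) := by
    funext ps; ring
  rw [e, pathMean_add, pathMean_add, pathMean_const_mul, pathMean_const hn,
    pathMean_totalMass hn hs]
  have hS : 0 ≤ ∑ l, x l ^ 2 := Finset.sum_nonneg fun _ _ => sq_nonneg _
  have := mul_nonneg hS (pow_nonneg (one_sub_inv_nonneg hn) k)
  nlinarith

/-! ### The law of the chain as a mean over paths -/

theorem tsum_bind_mul {α β : Type*} (p : PMF α) (q : α → PMF β) (g : β → ℝ≥0∞) :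
    ∑' y, (p.bind q) y * g y = ∑' x, p x * ∑' y, q x y * g y := by
  simp only [PMF.bind_apply, ← ENNReal.tsum_mul_right, ← ENNReal.tsum_mul_left]
  rw [ENNReal.tsum_comm]
  simp only [mul_assoc]

theorem tsum_pure_mul {α : Type*} (a : α) (g : α → ℝ≥0∞) : ∑' y, PMF.pure a y * g y = g a := by
  rw [tsum_eq_single a]
  · simp
  · intro b hb; simp [hb]

theorem pairMean_nonneg (hn : 2 ≤ n) {f : Fin n × Fin n → ℝ} (h : ∀ p, 0 ≤ f p) :
    0 ≤ pairMean f :=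
  div_nonneg (Finset.sum_nonneg fun p _ => h p) (pair_count_pos hn).le

theorem offDiag_nonempty (hn : 2 ≤ n) : (Finset.univ : Finset (Fin n)).offDiag.Nonempty :=
  ⟨(⟨0, by omega⟩, ⟨1, by omega⟩), by simp⟩

/-- Nonnegative `f` in `ℝ≥0∞` avoids any summability question over the uncountable state space. -/
theorem tsum_step_mul (hn : 2 ≤ n) (x : Fin n → ℝ) {f : (Fin n → ℝ) → ℝ} (hf : ∀ y, 0 ≤ f y) :
    ∑' y, step x y * ENNReal.ofReal (f y) =
      ENNReal.ofReal (pairMean fun p => f (averagePair x p)) := by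
  have hp := pair_count_pos hn
  rw [step, dif_pos (offDiag_nonempty hn), PMF.map, tsum_bind_mul]
  simp only [Function.comp_apply, tsum_pure_mul]
  rw [tsum_eq_sum (s := (Finset.univ : Finset (Fin n)).offDiag)
    (fun p hp => by rw [PMF.uniformOfFinset_apply_of_notMem _ hp, zero_mul])]
  rw [pairMean, ENNReal.ofReal_div_of_pos hp, ENNReal.ofReal_sum_of_nonneg fun p _ => hf _,
    div_eq_mul_inv, mul_comm, Finset.mul_sum]
  refine Finset.sum_congr rfl fun p hp => ?_
  rw [PMF.uniformOfFinset_apply_of_mem _ hp]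
  congr 2
  rw [Finset.offDiag_card, Finset.card_univ, Fintype.card_fin,
    ← ENNReal.ofReal_natCast, Nat.cast_sub (Nat.le_mul_self n)]
  congr 1
  push_cast
  ring

theorem tsum_law_mul (hn : 2 ≤ n) (x₀ : Fin n → ℝ) (k : ℕ) {f : (Fin n → ℝ) → ℝ}
    (hf : ∀ y, 0 ≤ f y) :
    ∑' y, law x₀ k y * ENNReal.ofReal (f y) =
      ENNReal.ofReal (pathMean k fun ps => f (run x₀ ps)) := by
  induction k generalizing f with
  | zero => simp only [law, tsum_pure_mul, pathMean, run]
  | succ k ih =>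
    rw [law, tsum_bind_mul]
    simp only [tsum_step_mul hn _ hf]
    rw [ih fun y => pairMean_nonneg hn fun p => hf _]
    rfl

theorem probDistGt_eq (hn : 2 ≤ n) (x₀ : Fin n → ℝ) (k : ℕ) (c : ℝ) :
    probDistGt x₀ k c =
      ENNReal.ofReal (pathMean k fun ps => if c < l1Dist x₀ (run x₀ ps) then 1 else 0) := by
  have hm : MeasurableSet {x : Fin n → ℝ | c < l1Dist x₀ x} := by
    refine measurableSet_lt measurable_const ?_
    unfold l1Dist
    fun_prop
  rw [probDistGt, PMF.toMeasure_apply _ hm,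
    ← tsum_law_mul hn x₀ k (f := fun x => if c < l1Dist x₀ x then 1 else 0)
      (fun y => by split_ifs <;> simp)]
  refine tsum_congr fun y => ?_
  by_cases h : c < l1Dist x₀ y <;> simp [h]

/-! ### The quantitative upper bound -/

/-- The dynamics is linear, and `|u - v| ≤ u + v` for the nonnegative part `y`: its mass is counted
once for the state and once for the mean. -/
theorem sum_abs_run_sub_mean_le {y z : Fin n → ℝ} (hn : 2 ≤ n) (hy : ∀ l, 0 ≤ y l)
    (qs : List (Fin n × Fin n)) :
    ∑ l, |run (y + z) qs l - mean (y + z)| ≤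
      2 * ∑ l, y l + ∑ l, |run z qs l - mean z| := by
  have hn0 : (n : ℝ) ≠ 0 := by positivity
  have hm : mean (y + z) = mean y + mean z := by
    simp only [mean, Pi.add_apply, Finset.sum_add_distrib, add_div]
  have hmy : 0 ≤ mean y := div_nonneg (Finset.sum_nonneg fun l _ => hy l) (Nat.cast_nonneg n)
  have hsum : ∑ l, (run y qs l + mean y) = 2 * ∑ l, y l := by
    rw [Finset.sum_add_distrib, sum_run]
    simp only [Finset.sum_const, Finset.card_univ, Fintype.card_fin, nsmul_eq_mul, mean]
    field_simp
    ring
  rw [← hsum, ← Finset.sum_add_distrib]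
  refine Finset.sum_le_sum fun l _ => ?_
  rw [run_add, hm, Pi.add_apply]
  have h1 : |run y qs l - mean y| ≤ run y qs l + mean y := by
    have := run_nonneg hy qs l
    rw [abs_le]; constructor <;> linarith
  calc |run y qs l + run z qs l - (mean y + mean z)|
      = |(run y qs l - mean y) + (run z qs l - mean z)| := by ring_nf
    _ ≤ _ := (abs_add_le _ _).trans (by linarith)

/-- Chebyshev for two causes: if `Y - b < ε/8` then `2 Y < 2 s + ε/2`, which forces `R > ε/2`. The
constants are `8²` and `2²`. -/
theorem indicator_le_of_le_add {s ε c b Y R Q : ℝ} (hε : 0 < ε) (hb : b ≤ s + ε / 8)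
    (hc : c ≤ 2 * Y + R) (hR : 0 ≤ R) (hQ : R ^ 2 ≤ Q) :
    (if 2 * s + ε < c then (1 : ℝ) else 0) ≤ 64 / ε ^ 2 * (Y - b) ^ 2 + 4 / ε ^ 2 * Q := by
  have hQ0 : 0 ≤ Q := (sq_nonneg R).trans hQ
  split_ifs with h
  · by_cases hY : ε / 8 ≤ Y - b
    · have h1 : 1 ≤ 64 / ε ^ 2 * (Y - b) ^ 2 := by
        rw [div_mul_eq_mul_div, le_div_iff₀ (by positivity)]
        nlinarith
      have : 0 ≤ 4 / ε ^ 2 * Q := by positivity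
      linarith
    · have h2 : ε / 2 ≤ R := by linarith
      have h1 : 1 ≤ 4 / ε ^ 2 * Q := by
        rw [div_mul_eq_mul_div, le_div_iff₀ (by positivity)]
        nlinarith
      have : 0 ≤ 64 / ε ^ 2 * (Y - b) ^ 2 := by positivity
      linarith
  · positivity

theorem sq_sum_abs_le (f : Fin n → ℝ) : (∑ l, |f l|) ^ 2 ≤ n * ∑ l, f l ^ 2 := by
  have := sq_sum_le_card_mul_sum_sq (s := (Finset.univ : Finset (Fin n))) (f := fun l => |f l|)
  simpa using this

/-- The error bound obtained by letting the chain run for `k₁` steps to spread the mass, for `k₂`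
steps during which the averagings are counted, and for `k₃` steps to mix the mass that has been
averaged at least `L` times. -/
def errorBound (n k₁ k₂ k₃ L : ℕ) : ℝ :=
  (2 * ((1 - 1 / (n : ℝ)) ^ k₁ + 1 / n) + 4 * k₂ / n ^ 2) +
    n * ((1 - 1 / (n : ℝ)) ^ k₃ * ((1 / 2) ^ L + k₂ / (n * (n - 1))))

theorem probDistGt_le_errorBound (hn : 2 ≤ n) {x₀ : Fin n → ℝ} (hx₀ : x₀ ∈ stdSimplex ℝ (Fin n))
    (k₁ k₂ k₃ L : ℕ) {s ε : ℝ} (hε : 0 < ε)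
    (hb : binomialMean (2 / n) k₂ (fun m => if L ≤ m then 0 else 1) ≤ s + ε / 8) :
    probDistGt x₀ (k₁ + k₂ + k₃) (2 * s + ε) ≤
      ENNReal.ofReal (64 / ε ^ 2 * errorBound n k₁ k₂ k₃ L) := by
  have hn2 : (2 : ℝ) ≤ n := by exact_mod_cast hn
  obtain ⟨hpos, hsum⟩ := hx₀
  rw [probDistGt_eq hn, pathMean_append, pathMean_append]
  refine ENNReal.ofReal_le_ofReal ?_
  set φ : ℕ → ℝ := fun m => if L ≤ m then 0 else 1 with hφ
  set χ : ℕ → ℝ := fun m => if L ≤ m then 1 else 0 with hχ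
  have hφ0 : ∀ m, 0 ≤ φ m := fun m => by simp only [hφ]; split_ifs <;> simp
  have hφ1 : ∀ m, φ m ≤ 1 := fun m => by simp only [hφ]; split_ifs <;> simp
  set b := binomialMean (2 / n) k₂ φ
  set A := (1 - 1 / (n : ℝ)) ^ k₃ with hA
  have hA0 : 0 ≤ A := pow_nonneg (one_sub_inv_nonneg hn) _
  -- the last phase
  have phase3 : ∀ x : Fin n → ℝ, (∀ i, 0 ≤ x i) → ∑ l, x l = 1 → mean x = mean x₀ →
      ∀ ps₂, pathMean k₃ (fun qs => if 2 * s + ε < l1Dist x₀ (run (run x ps₂) qs) then (1 : ℝ)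
        else 0) ≤ 64 / ε ^ 2 * (totalMass x ps₂ φ - b) ^ 2 +
          4 / ε ^ 2 * (n * (A * ∑ l, weightedMass x ps₂ χ l ^ 2)) := by
    intro x hx hs hm ps₂
    set y := weightedMass x ps₂ φ
    set z := weightedMass x ps₂ χ
    -- `φ + χ = 1` splits the state into mass with low count and mass with high count.
    have hyz : run x ps₂ = y + z := by
      rw [← weightedMass_one]
      funext l
      rw [Pi.add_apply, ← weightedMass_add]
      congr 1
      funext m
      simp only [hφ, hχ]
      split_ifs <;> simp
    have hmean : mean x₀ = mean (y + z) := by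
      rw [← hyz, ← hm, mean, mean, sum_run]
    refine (pathMean_mono hn k₃ (G := fun qs => 64 / ε ^ 2 * (totalMass x ps₂ φ - b) ^ 2 +
      4 / ε ^ 2 * (n * ∑ l, (run z qs l - mean z) ^ 2)) fun qs => ?_).trans ?_
    · refine indicator_le_of_le_add hε hb ?_ (Finset.sum_nonneg fun _ _ => abs_nonneg _)
        (sq_sum_abs_le fun l => run z qs l - mean z)
      rw [hyz, l1Dist, hmean]
      exact sum_abs_run_sub_mean_le hn (fun l => weightedMass_nonneg hx ps₂ hφ0 l) qs
    · rw [pathMean_add, pathMean_const hn, pathMean_const_mul, pathMean_const_mul]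
      have := pathMean_sum_sq_run_sub_mean_le hn z k₃
      gcongr
  -- the middle phase
  have phase2 : ∀ x : Fin n → ℝ, (∀ i, 0 ≤ x i) → ∑ l, x l = 1 → mean x = mean x₀ →
      pathMean k₂ (fun ps₂ => pathMean k₃ (fun qs => if 2 * s + ε <
        l1Dist x₀ (run (run x ps₂) qs) then (1 : ℝ) else 0)) ≤
        64 / ε ^ 2 * (2 * ∑ l, x l ^ 2 + 4 * k₂ / n ^ 2) +
          4 / ε ^ 2 * (n * (A * ((1 / 2) ^ L + k₂ / (n * (n - 1))))) := by
    intro x hx hs hm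
    refine (pathMean_mono hn k₂ fun ps₂ => phase3 x hx hs hm ps₂).trans ?_
    simp only [pathMean_add, pathMean_const_mul]
    have h1 := pathMean_totalMass_sub_sq_le hn hx hs k₂ hφ0 hφ1
    have h2 := pathMean_sum_sq_weightedMass_le hn hx hs k₂ L
    gcongr
  have hfin : ∀ ps₁, pathMean k₂ (fun ps₂ => pathMean k₃ (fun qs => if 2 * s + ε <
      l1Dist x₀ (run x₀ (qs ++ (ps₂ ++ ps₁))) then (1 : ℝ) else 0)) ≤
        64 / ε ^ 2 * (2 * ∑ l, run x₀ ps₁ l ^ 2 + 4 * k₂ / n ^ 2) +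
          4 / ε ^ 2 * (n * (A * ((1 / 2) ^ L + k₂ / (n * (n - 1))))) := by
    intro ps₁
    simp only [run_append]
    exact phase2 _ (run_nonneg hpos ps₁) (by rw [sum_run, hsum]) (by rw [mean, mean, sum_run])
  refine (pathMean_mono hn k₁ hfin).trans ?_
  simp only [pathMean_add, pathMean_const_mul, pathMean_const hn]
  -- The first phase bounds the `ℓ²` norm that controls the variance in the second.
  have h1 := pathMean_sum_sq_run_le_add hn hsum k₁
  have h2 : ∑ l, x₀ l ^ 2 ≤ 1 := by
    have := Finset.sum_sq_le_sq_sum_of_nonneg (s := Finset.univ) fun i _ => hpos i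
    simpa [hsum] using this
  have h3 : (1 - 1 / (n : ℝ)) ^ k₁ * ∑ l, x₀ l ^ 2 ≤ (1 - 1 / (n : ℝ)) ^ k₁ :=
    mul_le_of_le_one_right (pow_nonneg (one_sub_inv_nonneg hn) _) h2
  have h4 : pathMean k₁ (fun ps => ∑ l, run x₀ ps l ^ 2) ≤ (1 - 1 / (n : ℝ)) ^ k₁ + 1 / n := by
    linarith
  have hB : 0 ≤ n * (A * ((1 / 2) ^ L + k₂ / (n * ((n : ℝ) - 1)))) := by
    have := pair_count_pos hn
    positivity
  have h5 : 4 / ε ^ 2 * (n * (A * ((1 / 2) ^ L + k₂ / (n * ((n : ℝ) - 1))))) ≤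
      64 / ε ^ 2 * (n * (A * ((1 / 2) ^ L + k₂ / (n * ((n : ℝ) - 1))))) :=
    mul_le_mul_of_nonneg_right (by gcongr; norm_num) hB
  have h6 := mul_le_mul_of_nonneg_left h4 (show 0 ≤ 64 / ε ^ 2 by positivity)
  rw [errorBound, ← hA]
  linarith

/-! ### The central limit theorem for binomial distributions with varying parameters -/

/-- The binomial distribution with parameters `k` and `q`, as a measure on `ℝ`. -/
def binomialMeasure (q : ℝ) : ℕ → Measure ℝ
  | 0 => Measure.dirac 0
  | k + 1 => ENNReal.ofReal (1 - q) • binomialMeasure q k +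
      ENNReal.ofReal q • (binomialMeasure q k).map (· + 1)

theorem isProbabilityMeasure_binomialMeasure {q : ℝ} (h0 : 0 ≤ q) (h1 : q ≤ 1) (k : ℕ) :
    IsProbabilityMeasure (binomialMeasure q k) := by
  induction k with
  | zero => rw [binomialMeasure]; infer_instance
  | succ k ih =>
    have : IsProbabilityMeasure ((binomialMeasure q k).map (· + 1)) :=
      Measure.isProbabilityMeasure_map (by fun_prop)
    constructor
    simp only [binomialMeasure, Measure.add_apply, Measure.smul_apply, measure_univ, smul_eq_mul,
      mul_one]
    rw [← ENNReal.ofReal_add (by linarith) h0]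
    simp

theorem binomialMeasure_Iic {q : ℝ} (h0 : 0 ≤ q) (h1 : q ≤ 1) (k : ℕ) (t : ℝ) :
    (binomialMeasure q k).real (Set.Iic t) =
      binomialMean q k fun m => if (m : ℝ) ≤ t then 1 else 0 := by
  induction k generalizing t with
  | zero => simp [binomialMeasure, binomialMean, Measure.real, Set.indicator, apply_ite]
  | succ k ih =>
    have := isProbabilityMeasure_binomialMeasure h0 h1 k
    have e : (binomialMeasure q k).map (· + 1) (Set.Iic t) =
        binomialMeasure q k (Set.Iic (t - 1)) := by
      rw [Measure.map_apply (by fun_prop) measurableSet_Iic]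
      congr 1
      ext x
      simp [le_sub_iff_add_le]
    have e2 := ih (t - 1)
    simp only [le_sub_iff_add_le] at e2
    simp only [binomialMean, Nat.cast_add, Nat.cast_one]
    rw [← ih, ← e2]
    simp only [Measure.real, binomialMeasure, Measure.add_apply, Measure.smul_apply, smul_eq_mul, e]
    rw [ENNReal.toReal_add (ENNReal.mul_ne_top ENNReal.ofReal_ne_top (measure_ne_top _ _))
      (ENNReal.mul_ne_top ENNReal.ofReal_ne_top (measure_ne_top _ _)), ENNReal.toReal_mul,
      ENNReal.toReal_mul, ENNReal.toReal_ofReal (by linarith), ENNReal.toReal_ofReal h0]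

theorem charFun_binomialMeasure {q : ℝ} (h0 : 0 ≤ q) (h1 : q ≤ 1) (k : ℕ) (t : ℝ) :
    charFun (binomialMeasure q k) t = (1 + q * (Complex.exp (t * Complex.I) - 1)) ^ k := by
  induction k with
  | zero => simp [binomialMeasure]
  | succ k ih =>
    have := isProbabilityMeasure_binomialMeasure h0 h1 k
    have : IsProbabilityMeasure ((binomialMeasure q k).map (· + 1)) :=
      Measure.isProbabilityMeasure_map (by fun_prop)
    have hint : ∀ μ : Measure ℝ, IsProbabilityMeasure μ →
        Integrable (fun x : ℝ => Complex.exp (inner ℝ x t * Complex.I)) μ := by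
      intro μ _
      refine Integrable.of_bound (C := 1) (by fun_prop) (ae_of_all _ fun x => ?_)
      rw [Complex.norm_exp_ofReal_mul_I]
    have e : charFun (binomialMeasure q (k + 1)) t = (1 - q) * charFun (binomialMeasure q k) t +
        q * charFun ((binomialMeasure q k).map (· + 1)) t := by
      simp only [charFun_apply, binomialMeasure]
      rw [integral_add_measure ((hint _ inferInstance).smul_measure ENNReal.ofReal_ne_top)
        ((hint _ inferInstance).smul_measure ENNReal.ofReal_ne_top), integral_smul_measure,
        integral_smul_measure, ENNReal.toReal_ofReal (by linarith), ENNReal.toReal_ofReal h0]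
      simp
    rw [e, charFun_map_add_const, ih, pow_succ]
    simp
    ring

theorem norm_exp_sub_quadratic_le {z : ℂ} (hz : ‖z‖ ≤ 1) :
    ‖Complex.exp z - (1 + z + z ^ 2 / 2)‖ ≤ ‖z‖ ^ 3 * Real.exp 1 := by
  have h := Complex.norm_exp_sub_sum_le_norm_mul_exp z 3
  simp [Finset.sum_range_succ] at h
  refine h.trans ?_
  gcongr

/-- With `θ = t / √l` and `w = q (exp (iθ) - 1)`, the power is `exp (k log (1 + w))`. As `k q² → 0`,
the logarithm may be replaced by `w`, and `k w` by `k q (iθ - θ²/2)`. Here `k q θ² → t²`, while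
centring at `l` instead of `k q` leaves the drift `a t`. -/
theorem tendsto_charFun_binomial {q l : ℕ → ℝ} {k : ℕ → ℕ} {a : ℝ} (t : ℝ)
    (hl : Tendsto l atTop atTop) (hq : Tendsto q atTop (𝓝 0))
    (hkq : Tendsto (fun n => k n * q n ^ 2) atTop (𝓝 0))
    (h : Tendsto (fun n => (k n * q n - l n) / √(l n)) atTop (𝓝 a)) :
    Tendsto (fun n => (1 + q n * (Complex.exp (((√(l n))⁻¹ * t : ℝ) * Complex.I) - 1)) ^ k n *
        Complex.exp ((-l n * ((√(l n))⁻¹ * t) : ℝ) * Complex.I)) atTop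
      (𝓝 (Complex.exp (t * a * Complex.I - t ^ 2 / 2))) := by
  have hs : Tendsto (fun n => (√(l n))⁻¹) atTop (𝓝 0) :=
    (Real.tendsto_sqrt_atTop.comp hl).inv_tendsto_atTop
  have hθ : Tendsto (fun n => (√(l n))⁻¹ * t) atTop (𝓝 0) := by simpa using hs.mul_const t
  set θ : ℕ → ℝ := fun n => (√(l n))⁻¹ * t with hθd
  set w : ℕ → ℂ := fun n => q n * (Complex.exp (θ n * Complex.I) - 1) with hw
  have hlpos : ∀ᶠ n in atTop, 0 < l n := hl.eventually_gt_atTop 0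
  -- `k q θ² → t²`
  have hkl : Tendsto (fun n => k n * q n * ((√(l n))⁻¹) ^ 2) atTop (𝓝 1) := by
    have : Tendsto (fun n => (k n * q n - l n) / √(l n) * (√(l n))⁻¹ + 1) atTop (𝓝 1) := by
      simpa using (h.mul hs).add_const 1
    refine this.congr' ?_
    filter_upwards [hlpos] with n hn
    have h1 : √(l n) ≠ 0 := (Real.sqrt_pos.2 hn).ne'
    have h2 : √(l n) ^ 2 = l n := Real.sq_sqrt hn.le
    field_simp
    rw [h2]; ring
  have hkθ : Tendsto (fun n => k n * q n * θ n ^ 2) atTop (𝓝 (t ^ 2)) := by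
    have := hkl.mul_const (t ^ 2)
    rw [one_mul] at this
    refine this.congr fun n => ?_
    simp only [hθd]; ring
  have hwle : ∀ n, ‖w n‖ ≤ 2 * |q n| := by
    intro n
    have : ‖Complex.exp (θ n * Complex.I) - 1‖ ≤ 2 := by
      refine (norm_sub_le _ _).trans ?_
      rw [Complex.norm_exp_ofReal_mul_I, norm_one]; norm_num
    rw [hw]
    simp only [norm_mul, Complex.norm_real, Real.norm_eq_abs]
    nlinarith [abs_nonneg (q n)]
  have hw0 : Tendsto (fun n => ‖w n‖) atTop (𝓝 0) := by
    refine squeeze_zero (fun n => norm_nonneg _) hwle ?_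
    simpa using hq.abs.const_mul 2
  have hwhalf : ∀ᶠ n in atTop, ‖w n‖ < 1 / 2 := hw0.eventually_lt_const (by norm_num)
  -- the logarithm
  have A1 : Tendsto (fun n => (k n : ℂ) * (Complex.log (1 + w n) - w n)) atTop (𝓝 0) := by
    refine squeeze_zero_norm' (a := fun n => 4 * (k n * q n ^ 2)) ?_ (by simpa using hkq.const_mul 4)
    filter_upwards [hwhalf] with n hn
    have h1 := Complex.norm_log_one_add_sub_self_le (hn.trans (by norm_num : (1 : ℝ) / 2 < 1))
    have h2 : (1 - ‖w n‖)⁻¹ ≤ 2 := by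
      rw [inv_le_comm₀ (by linarith) (by norm_num)]; linarith
    have h3 : ‖w n‖ ^ 2 ≤ 4 * q n ^ 2 := by
      have := hwle n
      calc ‖w n‖ ^ 2 ≤ (2 * |q n|) ^ 2 := by gcongr
        _ = 4 * q n ^ 2 := by rw [mul_pow, sq_abs]; norm_num
    have h4 : ‖w n‖ ^ 2 * (1 - ‖w n‖)⁻¹ / 2 ≤ 4 * q n ^ 2 := by
      have : ‖w n‖ ^ 2 * (1 - ‖w n‖)⁻¹ ≤ ‖w n‖ ^ 2 * 2 := by gcongr
      linarith
    rw [norm_mul, Complex.norm_natCast]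
    calc (k n : ℝ) * ‖Complex.log (1 + w n) - w n‖ ≤ k n * (4 * q n ^ 2) := by
          gcongr
          exact h1.trans h4
      _ = _ := by ring
  have A2 : Tendsto (fun n => ((k n * q n : ℝ) : ℂ) * (Complex.exp (θ n * Complex.I) -
      (1 + θ n * Complex.I + (θ n * Complex.I) ^ 2 / 2))) atTop (𝓝 0) := by
    refine squeeze_zero_norm' (a := fun n => |k n * q n * θ n ^ 2| * |θ n| * Real.exp 1) ?_
      (by simpa using (hkθ.abs.mul hθ.abs).mul_const (Real.exp 1))
    have : ∀ᶠ n in atTop, |θ n| < 1 := by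
      have := hθ.abs
      rw [abs_zero] at this
      exact this.eventually_lt_const one_pos
    filter_upwards [this] with n hn
    have e : ‖(θ n : ℂ) * Complex.I‖ = |θ n| := by simp
    have h1 := norm_exp_sub_quadratic_le (z := θ n * Complex.I) (by rw [e]; exact hn.le)
    rw [norm_mul, Complex.norm_real, Real.norm_eq_abs]
    calc _ ≤ |k n * q n| * (|θ n| ^ 3 * Real.exp 1) := by rw [e] at h1; gcongr
      _ = _ := by rw [abs_mul _ (θ n ^ 2), abs_pow]; ring
  have A3 : Tendsto (fun n => ((k n * q n * θ n ^ 2 : ℝ) : ℂ)) atTop (𝓝 ((t ^ 2 : ℝ) : ℂ)) :=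
    (Complex.continuous_ofReal.tendsto _).comp hkθ
  have A4 : Tendsto (fun n => (((k n * q n - l n) / √(l n) * t : ℝ) : ℂ)) atTop
      (𝓝 ((a * t : ℝ) : ℂ)) :=
    (Complex.continuous_ofReal.tendsto _).comp (h.mul_const t)
  have A := ((A1.add A2).sub (A3.div_const 2)).add (A4.mul_const Complex.I)
  have B := (Complex.continuous_exp.tendsto _).comp A
  have lim : 0 + 0 - ((t ^ 2 : ℝ) : ℂ) / 2 + ((a * t : ℝ) : ℂ) * Complex.I =
      t * a * Complex.I - t ^ 2 / 2 := by push_cast; ring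
  rw [lim] at B
  refine B.congr' ?_
  filter_upwards [hwhalf] with n hn
  have hne : 1 + w n ≠ 0 := by
    intro h0
    have : w n = -1 := by linear_combination h0
    rw [this] at hn
    norm_num at hn
  have e1 : (1 + w n) ^ k n = Complex.exp (k n * Complex.log (1 + w n)) := by
    rw [Complex.exp_nat_mul, Complex.exp_log hne]
  have e2 : 1 + (q n : ℂ) * (Complex.exp (θ n * Complex.I) - 1) = 1 + w n := rfl
  rw [e2, e1, ← Complex.exp_add]
  simp only [Function.comp_apply]
  congr 1
  have e3 : (k n * q n - l n) / √(l n) * t = k n * q n * θ n - l n * θ n := by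
    simp only [hθd]; ring
  have e4 : -l n * ((√(l n))⁻¹ * t) = - (l n * θ n) := by simp only [hθd]; ring
  rw [e3, e4, hw]
  push_cast
  linear_combination (-(k n : ℂ) * q n * θ n ^ 2 / 2) * Complex.I_sq

theorem gaussianReal_Iic_zero (a : ℝ) :
    (gaussianReal a 1).real (Set.Iic 0) = stdNormalCDF (-a) := by
  have h : gaussianReal a 1 = (gaussianReal 0 1).map (· + a) := by
    rw [gaussianReal_map_add_const, zero_add]
  rw [stdNormalCDF, cdf_eq_real, h, Measure.real, Measure.real,
    Measure.map_apply (by fun_prop) measurableSet_Iic]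
  congr 2
  ext x
  simp [le_neg_iff_add_nonpos_left, add_comm]

/-- By Lévy continuity `(m - l) / √l` converges in law to a normal variable of mean `a` and variance
`1`. The event becomes the half-line up to `0`, whose boundary is null for the limit. -/
theorem tendsto_binomialMean_Iic {q l : ℕ → ℝ} {k : ℕ → ℕ} {a : ℝ} (h0 : ∀ n, 0 ≤ q n)
    (h1 : ∀ n, q n ≤ 1) (hl : Tendsto l atTop atTop) (hq : Tendsto q atTop (𝓝 0))
    (hkq : Tendsto (fun n => k n * q n ^ 2) atTop (𝓝 0))
    (h : Tendsto (fun n => (k n * q n - l n) / √(l n)) atTop (𝓝 a)) :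
    Tendsto (fun n => binomialMean (q n) (k n) fun m => if (m : ℝ) ≤ l n then 1 else 0) atTop
      (𝓝 (stdNormalCDF (-a))) := by
  have hP : ∀ n, IsProbabilityMeasure (((binomialMeasure (q n) (k n)).map (· + -l n)).map
      ((√(l n))⁻¹ * ·)) := fun n => by
    have := isProbabilityMeasure_binomialMeasure (h0 n) (h1 n) (k n)
    have : IsProbabilityMeasure ((binomialMeasure (q n) (k n)).map (· + -l n)) :=
      Measure.isProbabilityMeasure_map (by fun_prop)
    exact Measure.isProbabilityMeasure_map (by fun_prop)
  let μ : ℕ → ProbabilityMeasure ℝ := fun n => ⟨_, hP n⟩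
  let μ₀ : ProbabilityMeasure ℝ := ⟨gaussianReal a 1, inferInstance⟩
  have hμ : Tendsto μ atTop (𝓝 μ₀) := by
    refine ProbabilityMeasure.tendsto_of_tendsto_charFun fun t => ?_
    have e : charFun (μ₀ : Measure ℝ) t = Complex.exp (t * a * Complex.I - t ^ 2 / 2) := by
      change charFun (gaussianReal a 1) t = _
      rw [charFun_gaussianReal]
      simp
    rw [e]
    refine (tendsto_charFun_binomial t hl hq hkq h).congr fun n => ?_
    change _ = charFun (((binomialMeasure (q n) (k n)).map (· + -l n)).map
      ((√(l n))⁻¹ * ·)) t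
    rw [charFun_map_mul, charFun_map_add_const, charFun_binomialMeasure (h0 n) (h1 n)]
    congr 3
    simp [mul_comm]
  have hfr : (μ₀ : Measure ℝ) (frontier (Set.Iic 0)) = 0 := by
    have : NullSingletonClass (gaussianReal a 1) :=
      nullSingletonClass_gaussianReal one_ne_zero
    rw [frontier_Iic]
    exact measure_singleton (μ := gaussianReal a 1) 0
  have hlim := ProbabilityMeasure.tendsto_measure_of_null_frontier_of_tendsto' hμ hfr
  have hlim' := (ENNReal.tendsto_toReal (measure_ne_top (μ₀ : Measure ℝ) (Set.Iic 0))).comp hlim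
  have e : ((μ₀ : Measure ℝ) (Set.Iic 0)).toReal = stdNormalCDF (-a) := gaussianReal_Iic_zero a
  rw [e] at hlim'
  refine hlim'.congr' ?_
  filter_upwards [hl.eventually_gt_atTop 0] with n hn
  rw [← binomialMeasure_Iic (h0 n) (h1 n)]
  change (((binomialMeasure (q n) (k n)).map (· + -l n)).map
      ((√(l n))⁻¹ * ·) (Set.Iic 0)).toReal = _
  rw [Measure.map_apply (by fun_prop) measurableSet_Iic,
    Measure.map_apply (by fun_prop) (measurableSet_Iic.preimage (by fun_prop)), Measure.real]
  congr 2
  ext x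
  have := Real.sqrt_pos.2 hn
  simp only [Set.mem_preimage, Set.mem_Iic]
  rw [mul_nonpos_iff_pos_imp_nonpos]
  constructor
  · intro hx; linarith [hx.1 (by positivity)]
  · intro hx
    exact ⟨fun _ => by linarith, fun hx' => by linarith [inv_pos.2 this]⟩

/-! ### Asymptotics at the cutoff time -/

theorem binomialMean_mono {q : ℝ} (h0 : 0 ≤ q) (h1 : q ≤ 1) (k : ℕ) {φ ψ : ℕ → ℝ}
    (h : ∀ m, φ m ≤ ψ m) : binomialMean q k φ ≤ binomialMean q k ψ := by
  induction k generalizing φ ψ with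
  | zero => exact h 0
  | succ k ih =>
    exact add_le_add (mul_le_mul_of_nonneg_left (ih h) (by linarith))
      (mul_le_mul_of_nonneg_left (ih fun m => h (m + 1)) h0)

theorem tendsto_logb_natCast : Tendsto (fun n : ℕ => Real.logb 2 n) atTop atTop :=
  (Real.tendsto_logb_atTop one_lt_two).comp tendsto_natCast_atTop_atTop

theorem tendsto_logb_div_natCast : Tendsto (fun n : ℕ => Real.logb 2 n / n) atTop (𝓝 0) := by
  have h := (Real.isLittleO_log_id_atTop.tendsto_div_nhds_zero.comp
    tendsto_natCast_atTop_atTop).div_const (Real.log 2)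
  rw [zero_div] at h
  refine h.congr fun n => ?_
  simp only [Function.comp_apply, id, Real.logb]
  ring

/-- The number of blocks of `n` steps used for the spreading phase and for the mixing phase. -/
def blocks (n : ℕ) : ℕ := ⌊√(√(Real.logb 2 n))⌋₊

theorem tendsto_blocks : Tendsto blocks atTop atTop :=
  tendsto_nat_floor_atTop.comp (Real.tendsto_sqrt_atTop.comp
    (Real.tendsto_sqrt_atTop.comp tendsto_logb_natCast))

/-- Makes `log₂ n` polynomial in the number of blocks, so that `exp (-blocks n)` absorbs it. -/
theorem logb_le_blocks_pow (n : ℕ) : Real.logb 2 n ≤ ((blocks n : ℝ) + 1) ^ 4 := by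
  rcases le_or_gt (Real.logb 2 n) 0 with h | h
  · exact h.trans (by positivity)
  · have h1 : √(√(Real.logb 2 n)) ≤ blocks n + 1 := (Nat.lt_floor_add_one _).le
    calc Real.logb 2 n = (√(√(Real.logb 2 n)) ^ 2) ^ 2 := by
          rw [Real.sq_sqrt (Real.sqrt_nonneg _), Real.sq_sqrt h.le]
      _ = √(√(Real.logb 2 n)) ^ 4 := by ring
      _ ≤ _ := by gcongr

/-- The spreading and mixing phases do not shift the value of `a`. -/
theorem tendsto_blocks_div : Tendsto (fun n => (blocks n : ℝ) / √(Real.logb 2 n)) atTop (𝓝 0) := by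
  have h : Tendsto (fun n : ℕ => (√(√(Real.logb 2 n)))⁻¹) atTop (𝓝 0) :=
    (Real.tendsto_sqrt_atTop.comp
      (Real.tendsto_sqrt_atTop.comp tendsto_logb_natCast)).inv_tendsto_atTop
  refine squeeze_zero (fun n => by positivity) (fun n => ?_) h
  have h1 : (blocks n : ℝ) ≤ √(√(Real.logb 2 n)) := Nat.floor_le (Real.sqrt_nonneg _)
  calc (blocks n : ℝ) / √(Real.logb 2 n) ≤ √(√(Real.logb 2 n)) / √(Real.logb 2 n) := by gcongr
    _ = _ := Real.sqrt_div_self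

/-- The number of steps in the phase during which the averagings are counted. -/
def countingTime (a : ℝ) (n : ℕ) : ℕ := cutoffTime n a - 2 * (n * blocks n)

theorem tendsto_inv_sqrt_logb : Tendsto (fun n : ℕ => (√(Real.logb 2 n))⁻¹) atTop (𝓝 0) :=
  (Real.tendsto_sqrt_atTop.comp tendsto_logb_natCast).inv_tendsto_atTop

theorem eventually_one_le_sub_blocks (a : ℝ) :
    ∀ᶠ n : ℕ in atTop, 1 ≤ Real.logb 2 n + a * √(Real.logb 2 n) - 4 * blocks n := by
  have h : Tendsto (fun n : ℕ => √(Real.logb 2 n) *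
      (√(Real.logb 2 n) + (a - 4 * (blocks n / √(Real.logb 2 n))))) atTop atTop := by
    have hs := Real.tendsto_sqrt_atTop.comp tendsto_logb_natCast
    exact hs.atTop_mul_atTop₀ (hs.atTop_add ((tendsto_blocks_div.const_mul 4).const_sub a))
  filter_upwards [h.eventually_ge_atTop 1, tendsto_logb_natCast.eventually_gt_atTop 0]
    with n hn h0
  refine hn.trans (le_of_eq ?_)
  have h1 := (Real.sqrt_pos.2 h0).ne'
  have h2 := Real.sq_sqrt h0.le
  field_simp
  linear_combination h2

/-- The floor loses at most one step, worth `2 / n ≤ 1`. The last bound makes the truncated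
subtraction in `countingTime` exact. -/
theorem eventually_cutoffTime_bounds (a : ℝ) :
    ∀ᶠ n : ℕ in atTop,
      2 / (n : ℝ) * cutoffTime n a ≤ Real.logb 2 n + a * √(Real.logb 2 n) ∧
      Real.logb 2 n + a * √(Real.logb 2 n) - 1 ≤ 2 / (n : ℝ) * cutoffTime n a ∧
      2 * (n * blocks n) ≤ cutoffTime n a := by
  filter_upwards [eventually_one_le_sub_blocks a, eventually_ge_atTop 2] with n h hn
  have hn2 : (2 : ℝ) ≤ n := by exact_mod_cast hn
  set u := Real.logb 2 n + a * √(Real.logb 2 n) with hu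
  have hb : (0 : ℝ) ≤ blocks n := Nat.cast_nonneg _
  have h1 : (cutoffTime n a : ℝ) ≤ n * u / 2 := Nat.floor_le (by
    have : 0 ≤ u := by linarith
    positivity)
  have h2 : n * u / 2 < cutoffTime n a + 1 := Nat.lt_floor_add_one _
  refine ⟨?_, ?_, ?_⟩
  · rw [div_mul_eq_mul_div, div_le_iff₀ (by linarith)]; linarith
  · rw [div_mul_eq_mul_div, le_div_iff₀ (by linarith)]; linarith
  · have : (2 * (n * blocks n) : ℝ) < cutoffTime n a + 1 := by nlinarith
    exact Nat.lt_succ_iff.1 (by exact_mod_cast this)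

theorem eventually_countingTime_cast (a : ℝ) :
    ∀ᶠ n : ℕ in atTop,
      (countingTime a n : ℝ) * (2 / n) = 2 / (n : ℝ) * cutoffTime n a - 4 * blocks n := by
  filter_upwards [eventually_cutoffTime_bounds a, eventually_ge_atTop 2] with n h hn
  have hn0 : (n : ℝ) ≠ 0 := by positivity
  rw [countingTime, Nat.cast_sub h.2.2]
  push_cast
  field_simp
  ring

theorem tendsto_countingTime (a : ℝ) :
    Tendsto (fun n : ℕ => ((countingTime a n : ℝ) * (2 / n) - Real.logb 2 n) / √(Real.logb 2 n))
      atTop (𝓝 a) := by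
  have h1 : Tendsto (fun n : ℕ => (2 / (n : ℝ) * cutoffTime n a -
      (Real.logb 2 n + a * √(Real.logb 2 n))) * (√(Real.logb 2 n))⁻¹) atTop (𝓝 0) := by
    refine squeeze_zero_norm' ?_ tendsto_inv_sqrt_logb
    filter_upwards [eventually_cutoffTime_bounds a] with n h
    rw [norm_mul, Real.norm_eq_abs, Real.norm_eq_abs, abs_of_nonneg (a := (√(Real.logb 2 n))⁻¹)
      (by positivity)]
    refine mul_le_of_le_one_left (by positivity) ?_
    rw [abs_le]
    constructor <;> linarith [h.1, h.2.1]
  have h2 := (h1.add_const a).sub (tendsto_blocks_div.const_mul 4)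
  simp only [zero_add, mul_zero, sub_zero] at h2
  refine h2.congr' ?_
  filter_upwards [eventually_countingTime_cast a, tendsto_logb_natCast.eventually_gt_atTop 0]
    with n h h0
  have := (Real.sqrt_pos.2 h0).ne'
  rw [h]
  field_simp
  ring

theorem eventually_countingTime_le (a : ℝ) :
    ∀ᶠ n : ℕ in atTop, (countingTime a n : ℝ) * (2 / n) ≤ (1 + |a|) * Real.logb 2 n := by
  filter_upwards [eventually_countingTime_cast a, eventually_cutoffTime_bounds a,
    tendsto_logb_natCast.eventually_ge_atTop 1] with n h h1 h2
  have h3 : √(Real.logb 2 n) ≤ Real.logb 2 n := by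
    rw [Real.sqrt_le_left (by linarith)]
    nlinarith
  have h4 : a * √(Real.logb 2 n) ≤ |a| * Real.logb 2 n :=
    mul_le_mul (le_abs_self a) h3 (Real.sqrt_nonneg _) (abs_nonneg a)
  have hb : (0 : ℝ) ≤ blocks n := Nat.cast_nonneg _
  rw [h]
  linarith [h1.1]

theorem tendsto_countingTime_mul_sq (a : ℝ) :
    Tendsto (fun n : ℕ => (countingTime a n : ℝ) * (2 / n) ^ 2) atTop (𝓝 0) := by
  have h := tendsto_logb_div_natCast.const_mul (2 * (1 + |a|))
  rw [mul_zero] at h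
  refine squeeze_zero' (Eventually.of_forall fun n => by positivity) ?_ h
  filter_upwards [eventually_countingTime_le a] with n hn
  calc (countingTime a n : ℝ) * (2 / n) ^ 2 = (countingTime a n : ℝ) * (2 / n) * (2 / n) := by ring
    _ ≤ (1 + |a|) * Real.logb 2 n * (2 / n) := by gcongr
    _ = _ := by ring

theorem one_sub_inv_pow_le {n : ℕ} (hn : 2 ≤ n) (r : ℕ) :
    (1 - 1 / (n : ℝ)) ^ (n * r) ≤ Real.exp (-r) := by
  have hn0 : (n : ℝ) ≠ 0 := by positivity
  calc (1 - 1 / (n : ℝ)) ^ (n * r) ≤ Real.exp (-(1 / n)) ^ (n * r) :=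
        pow_le_pow_left₀ (one_sub_inv_nonneg hn) (Real.one_sub_le_exp_neg _) _
    _ = Real.exp (-r) := by
        rw [← Real.exp_nat_mul]
        congr 1
        push_cast
        field_simp

/-- Rounding `log₂ n` down costs at most a factor `2`. -/
theorem mul_half_pow_floor_logb_le {n : ℕ} (hn : 1 ≤ n) :
    (n : ℝ) * (1 / 2) ^ ⌊Real.logb 2 n⌋₊ ≤ 2 := by
  have hn0 : (0 : ℝ) < n := by exact_mod_cast hn
  have h : (n : ℝ) ≤ 2 ^ (⌊Real.logb 2 n⌋₊ + 1) := by
    calc (n : ℝ) = (2 : ℝ) ^ Real.logb 2 n := (Real.rpow_logb two_pos (by norm_num) hn0).symm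
      _ ≤ (2 : ℝ) ^ ((⌊Real.logb 2 n⌋₊ + 1 : ℕ) : ℝ) := by
          refine Real.rpow_le_rpow_of_exponent_le one_le_two ?_
          push_cast
          exact (Nat.lt_floor_add_one _).le
      _ = _ := Real.rpow_natCast _ _
  rw [one_div, inv_pow, ← div_eq_mul_inv, div_le_iff₀ (by positivity)]
  rw [pow_succ] at h
  linarith

theorem tendsto_errorBound (a : ℝ) :
    Tendsto (fun n : ℕ => errorBound n (n * blocks n) (countingTime a n) (n * blocks n)
      ⌊Real.logb 2 n⌋₊) atTop (𝓝 0) := by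
  have hr : Tendsto (fun n => (blocks n : ℝ)) atTop atTop :=
    tendsto_natCast_atTop_atTop.comp tendsto_blocks
  have e1 : Tendsto (fun n => Real.exp (-(blocks n : ℝ))) atTop (𝓝 0) :=
    Real.tendsto_exp_neg_atTop_nhds_zero.comp hr
  have e2 : Tendsto (fun n => Real.exp (-(blocks n : ℝ)) * ((blocks n : ℝ) + 1) ^ 4) atTop
      (𝓝 0) := by
    have h := ((Real.tendsto_pow_mul_exp_neg_atTop_nhds_zero 4).comp
      (tendsto_atTop_add_const_right _ 1 hr)).const_mul (Real.exp 1)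
    rw [mul_zero] at h
    refine h.congr fun n => ?_
    simp only [Function.comp_apply]
    rw [mul_comm (_ ^ 4), ← mul_assoc, ← Real.exp_add]
    ring_nf
  have e3 : Tendsto (fun n : ℕ => 1 / (n : ℝ)) atTop (𝓝 0) := tendsto_one_div_atTop_nhds_zero_nat
  have e4 := (((e1.add e3).const_mul 2).add (tendsto_countingTime_mul_sq a)).add
    ((e1.const_mul 2).add (e2.const_mul (1 + |a|)))
  simp only [add_zero, mul_zero] at e4
  refine squeeze_zero' ?_ ?_ e4
  · filter_upwards [eventually_ge_atTop 2] with n hn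
    have := one_sub_inv_nonneg hn
    have := pair_count_pos hn
    unfold errorBound
    positivity
  · filter_upwards [eventually_ge_atTop 2, eventually_countingTime_le a] with n hn hc
    have hn2 : (2 : ℝ) ≤ n := by exact_mod_cast hn
    have hp := one_sub_inv_pow_le hn (blocks n)
    have hA := pow_nonneg (one_sub_inv_nonneg hn) (n * blocks n)
    have h1 : (n : ℝ) * ((countingTime a n : ℝ) / (n * (n - 1))) ≤
        (1 + |a|) * (blocks n + 1) ^ 4 := by
      calc (n : ℝ) * ((countingTime a n : ℝ) / (n * (n - 1))) = countingTime a n / (n - 1) := by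
            have : (n : ℝ) - 1 ≠ 0 := by linarith
            field_simp
        _ ≤ countingTime a n * (2 / n) := by
            rw [div_eq_mul_inv]
            gcongr
            rw [inv_le_iff_one_le_mul₀ (by linarith), div_mul_eq_mul_div,
              le_div_iff₀ (by linarith)]
            linarith
        _ ≤ (1 + |a|) * Real.logb 2 n := hc
        _ ≤ _ := by
            have := logb_le_blocks_pow n
            gcongr
    have h2 := mul_half_pow_floor_logb_le (n := n) (by omega)
    have h3 : (n : ℝ) * ((1 - 1 / (n : ℝ)) ^ (n * blocks n) *
        ((1 / 2) ^ ⌊Real.logb 2 n⌋₊ + countingTime a n / (n * (n - 1)))) ≤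
        Real.exp (-(blocks n : ℝ)) * (2 + (1 + |a|) * (blocks n + 1) ^ 4) := by
      calc _ = (1 - 1 / (n : ℝ)) ^ (n * blocks n) * ((n : ℝ) * (1 / 2) ^ ⌊Real.logb 2 n⌋₊ +
            n * (countingTime a n / (n * (n - 1)))) := by ring
        _ ≤ (1 - 1 / (n : ℝ)) ^ (n * blocks n) * (2 + (1 + |a|) * (blocks n + 1) ^ 4) := by
            gcongr
        _ ≤ _ := by gcongr
    have h4 : 4 * (countingTime a n : ℝ) / n ^ 2 = countingTime a n * (2 / n) ^ 2 := by ring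
    rw [errorBound, h4]
    linarith

theorem eventually_binomialMean_le (a : ℝ) {η : ℝ} (hη : 0 < η) :
    ∀ᶠ n : ℕ in atTop, binomialMean (2 / n) (countingTime a n)
      (fun m => if ⌊Real.logb 2 n⌋₊ ≤ m then 0 else 1) ≤ stdNormalCDF (-a) + η := by
  -- At `n = 1` the value `2 / n` is not a probability; the limit theorem asks for all `n`.
  have hq : ∀ᶠ n : ℕ in atTop, min 1 (2 / (n : ℝ)) = 2 / n := by
    filter_upwards [eventually_ge_atTop 2] with n hn
    have hn2 : (2 : ℝ) ≤ n := by exact_mod_cast hn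
    exact min_eq_right ((div_le_one (by linarith)).2 hn2)
  have hq0 : Tendsto (fun n : ℕ => min 1 (2 / (n : ℝ))) atTop (𝓝 0) :=
    (tendsto_const_div_atTop_nhds_zero_nat 2).congr' (hq.mono fun n hn => hn.symm)
  have h := tendsto_binomialMean_Iic (q := fun n : ℕ => min 1 (2 / (n : ℝ)))
    (k := countingTime a) (fun n => by positivity) (fun n => min_le_left _ _) tendsto_logb_natCast hq0
    ((tendsto_countingTime_mul_sq a).congr' (hq.mono fun n hn => by simp only [hn]))
    ((tendsto_countingTime a).congr' (hq.mono fun n hn => by simp only [hn]))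
  filter_upwards [h.eventually_le_const (show stdNormalCDF (-a) < stdNormalCDF (-a) + η by linarith),
    hq, eventually_ge_atTop 1] with n hn hqn hn1
  refine le_trans ?_ hn
  have hn1' : (1 : ℝ) ≤ n := by exact_mod_cast hn1
  rw [hqn]
  refine binomialMean_mono (by positivity) (by rw [← hqn]; exact min_le_left _ _) _ fun m => ?_
  split_ifs with h1 h2 h2
  · exact zero_le_one
  · exact le_rfl
  · exact le_rfl
  -- A count below `⌊log₂ n⌋` is at most `log₂ n`, so an inequality suffices.
  · refine absurd ((Nat.cast_le.2 (not_le.1 h1).le).trans (Nat.floor_le ?_)) h2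
    exact Real.logb_nonneg one_lt_two hn1'

end RepeatedAverages

end

theorem theorem3 (a : ℝ) (ε : ℝ) (hε : 0 < ε) :
    Tendsto
      (fun n : ℕ => ⨆ x₀ ∈ stdSimplex ℝ (Fin n),
        RepeatedAverages.probDistGt x₀ (RepeatedAverages.cutoffTime n a)
          (2 * RepeatedAverages.stdNormalCDF (-a) + ε))
      atTop (𝓝 0) := by
  have h := (ENNReal.continuous_ofReal.tendsto _).comp
    ((RepeatedAverages.tendsto_errorBound a).const_mul (64 / ε ^ 2))
  rw [mul_zero, ENNReal.ofReal_zero] at h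
  refine tendsto_of_tendsto_of_tendsto_of_le_of_le' tendsto_const_nhds h
    (Eventually.of_forall fun n => zero_le) ?_
  -- The slack `ε / 8` is the one allowed by `probDistGt_le_errorBound`, whose bound does not depend
  -- on `x₀` and so passes to the supremum.
  filter_upwards [eventually_ge_atTop 2, RepeatedAverages.eventually_cutoffTime_bounds a,
    RepeatedAverages.eventually_binomialMean_le a (show 0 < ε / 8 by linarith)] with n hn hK hb
  refine iSup₂_le fun x₀ hx₀ => ?_
  have e : RepeatedAverages.cutoffTime n a = n * RepeatedAverages.blocks n +
      RepeatedAverages.countingTime a n + n * RepeatedAverages.blocks n := by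
    have := hK.2.2
    rw [RepeatedAverages.countingTime]
    omega
  rw [e]
  exact RepeatedAverages.probDistGt_le_errorBound hn hx₀ _ _ _ _ hε hb
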